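/- Let $\|\cdot\|$ be a norm on $\mathbb{R}^3$ that is smooth ($C^\infty$ away from the origin) and strictly convex, with unit sphere $\partial B=\{x:\|x\|=1\}$, and assume that the usual (Euclidean) Gaussian curvature of $\partial B$ vanishes nowhere. Let $M$ be a closed surface, i.e. a compact connected smooth two-dimensional manifold without boundary, let $f:M\to\mathbb{R}^3$ be a smooth embedding, and let $\eta:M\to\partial B$ be its Birkhoff-Gauss map, i.e. a continuous map such that for every $p\in M$ the unit vector $\eta(p)$ is Birkhoff orthogonal to the tangent plane $T_pM\cong df_p(T_pM)$: $\|\eta(p)\|\le\|\eta(p)+tw\|$ for all $w\in df_p(T_pM)$ and $t\in\mathbb{R}$. (Such an $\eta$ is unique up to sign; the quantities below do not depend on the sign.) Let $K(p)=\det(d\eta_p)$ be the Minkowski Gaussian curvature, where $d\eta_p$ is regarded as an endomorphism of $T_pM$, and let $\omega(X,Y)=\det(X,Y,\eta)$ be the induced area element, $M$ being oriented so that $\omega$ is positive. If $K(p)>0$ for every $p\in M$, then $$\int_M K\,\omega=\lambda(\partial B),$$ where $\lambda(\partial B)=\int_{\partial B}\omega$ is the area of the unit sphere with respect to its own area element $\omega(X,Y)=\det(X,Y,x)$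 at $x\in\partial B$ (the outward Birkhoff normal of $\partial B$ at $x$ being $x$ itself). -/

import Mathlib

open Set MeasureTheory Topology
open scoped Manifold ContDiff

noncomputable section

/-- The space `ℝ³` with its usual (auxiliary) Euclidean structure. -/
abbrev E3 : Type := EuclideanSpace ℝ (Fin 3)

/-- The usual determinant `det (X, Y, Z)` of three vectors of `ℝ³`. -/
def det3 (X Y Z : E3) : ℝ :=
  (EuclideanSpace.basisFun (Fin 3) ℝ).toBasis.det ![X, Y, Z]

/-- Let `i : V → ℝ³` be the injective inclusion of a tangent plane (the differential of an
immersion) and let `A : V → ℝ³` be the differential of a normal map, whose range is contained in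
the range of `i`. Identifying `V` with `i V`, the map `A` is an endomorphism of `V`; this is its
determinant. (On the range of `i` every left inverse of `i` is the inverse of `i`.) -/
def tangentialDet {V : Type*} [AddCommGroup V] [Module ℝ V] (i A : V →ₗ[ℝ] E3) : ℝ :=
  LinearMap.det (i.leftInverse ∘ₗ A)

/-- The usual Gauss map of the level surfaces of `N`: the Euclidean unit normal `∇N / |∇N|`
(outward pointing on the unit sphere of `N`). -/
def euclideanGaussMap (N : Seminorm ℝ E3) (x : E3) : E3 :=
  ‖gradient N x‖⁻¹ • gradient N x

/-- The usual Gaussian curvature of the surface `{N = 1}` at a point `x` of it: the determinant of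
the differential of its usual Gauss map on the tangent plane, which is the kernel of `dN_x`. -/
def unitSphereEuclideanGaussCurvature (N : Seminorm ℝ E3) (x : E3) : ℝ :=
  tangentialDet (fderiv ℝ N x).ker.subtype
    ((fderiv ℝ (euclideanGaussMap N) x).toLinearMap ∘ₗ (fderiv ℝ N x).ker.subtype)

/-- `N` is an admissible norm: a norm on `ℝ³` that is smooth (away from the origin) and strictly
convex, and whose unit sphere has nowhere vanishing usual Gaussian curvature. -/
structure IsMinkowskiNorm (N : Seminorm ℝ E3) : Prop where
  eq_zero_of_apply_eq_zero : ∀ x, N x = 0 → x = 0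
  smooth : ContDiffOn ℝ ∞ N {0}ᶜ
  strictConvex : StrictConvex ℝ {x | N x ≤ 1}
  curvature_ne_zero : ∀ x, N x = 1 → unitSphereEuclideanGaussCurvature N x ≠ 0

/-- The vector `v` is Birkhoff orthogonal to the linear subspace `H`. -/
def BirkhoffOrthogonal (N : Seminorm ℝ E3) (v : E3) (H : Submodule ℝ E3) : Prop :=
  ∀ w ∈ H, ∀ t : ℝ, N v ≤ N (v + t • w)

section Surface

variable {M : Type*} [TopologicalSpace M] [ChartedSpace (EuclideanSpace ℝ (Fin 2)) M]

/-- `η` is a Birkhoff-Gauss map of the immersed surface `f : M → ℝ³`: a continuous choice of unit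
vectors (for `N`) that are Birkhoff orthogonal to the tangent planes `df_p (T_p M)`. -/
structure IsBirkhoffGaussMap (N : Seminorm ℝ E3) (f η : M → E3) : Prop where
  continuous : Continuous η
  unit : ∀ p, N (η p) = 1
  orthogonal : ∀ p, BirkhoffOrthogonal N (η p) (mvfderiv (𝓡 2) f p).range

/-- The Minkowski Gaussian curvature `K(p) = det (dη_p)` of the surface `f` with Birkhoff-Gauss map
`η`, where `T_p M` is identified with `df_p (T_p M)`. -/
def minkowskiGaussCurvature (f η : M → E3) (p : M) : ℝ :=
  tangentialDet (mvfderiv (𝓡 2) f p).toLinearMap (mvfderiv (𝓡 2) η p).toLinearMap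

/-- In the local parametrization `φ = f ∘ e⁻¹` given by a chart `e`, the coefficient
`ω (φ_u, φ_v) = det (φ_u, φ_v, η)` of the area element. -/
def areaCoefficient (f η : M → E3) (e : OpenPartialHomeomorph M (EuclideanSpace ℝ (Fin 2)))
    (x : EuclideanSpace ℝ (Fin 2)) : ℝ :=
  det3 (fderiv ℝ (f ∘ e.symm) x (EuclideanSpace.single 0 1))
    (fderiv ℝ (f ∘ e.symm) x (EuclideanSpace.single 1 1)) (η (e.symm x))

/-- The area measure carried by the domain of a chart `e`, i.e.
`A ↦ ∫_{e (A ∩ e.source)} |ω (φ_u, φ_v)| du dv`. The absolute value amounts to using positively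
oriented parametrizations, so that areas are positive. -/
def chartAreaMeasure [MeasurableSpace M] (f η : M → E3)
    (e : OpenPartialHomeomorph M (EuclideanSpace ℝ (Fin 2))) : Measure M :=
  ((volume.restrict e.target).withDensity
    fun x ↦ ENNReal.ofReal |areaCoefficient f η e x|).map e.symm

/-- The area measure `λ_M` of the surface, i.e. integration against the area element `ω`. By the
change of variables formula the measures of the charts agree on overlaps, and `λ_M` is the measure
obtained by gluing them, that is, the least measure dominating all of them. -/
def areaMeasure [MeasurableSpace M] (f η : M → E3) : Measure M :=
  ⨆ e ∈ atlas (EuclideanSpace ℝ (Fin 2)) M, chartAreaMeasure f η e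

end Surface

/-- The unit sphere `∂B` of `N` as an embedded surface: the radial projection `x ↦ x / N x` of the
Euclidean unit sphere onto `∂B`. -/
def unitSphereEmbedding (N : Seminorm ℝ E3) (x : Metric.sphere (0 : E3) 1) : E3 :=
  (N (x : E3))⁻¹ • (x : E3)

/-- The area `λ(∂B) = ∫_{∂B} ω` of the unit sphere of `N`. The (outward) Birkhoff-Gauss map of `∂B`
assigns to a point of `∂B` its position vector. -/
def unitSphereArea (N : Seminorm ℝ E3) : ℝ :=
  (areaMeasure (unitSphereEmbedding N) (unitSphereEmbedding N)).real univ

end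

/-! Birkhoff orthogonality of `η p` to the tangent plane means that this plane lies in the kernel of
`dN` at `η p`, and by dimension equals it. So the tangent planes of `M` at `p` and of `∂B` at `η p`
coincide, `dη_p` is an endomorphism of that plane, and `det (η_u, η_v, η) = K · det (f_u, f_v, η)`:
the form `K ω` is the pullback under `η` of the area element of `∂B`
(`areaCoefficient_eq_minkowskiGaussCurvature_mul`, `areaMeasure_birkhoffGaussMap`).

As `K` does not vanish, `η` is a local diffeomorphism onto `∂B`, by the inverse function theorem. A
local homeomorphism from a compact connected surface to a sphere is a covering, and the sphere has
no nontrivial connected coverings, so `η` is bijective (`IsLocalHomeomorph.bijective_of_sphere`).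
Change of variables (`areaMeasure_univ_comp`) then gives `∫ K ω = λ(∂B)`; positivity of `K` removes
the absolute value.

The map `η` is only assumed continuous. Its smoothness comes from the nonvanishing Euclidean
curvature of `∂B`: the Euclidean normal of `M` is smooth, and the Gauss map of `∂B` can be inverted
locally to recover `η` from it (`IsMinkowskiNorm.contDiffAt_of_tangent`). -/

noncomputable section

/-! ### Coverings of the two-sphere. -/

/-- A covering of the two-sphere by a connected space is injective: the sections over the
complements of two antipodal points agree on the (connected) overlap and glue. -/
theorem IsCoveringMap.injective_of_sphere {M : Type*} [TopologicalSpace M] [ConnectedSpace M]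
    {p : M → Metric.sphere (0 : E3) 1} (hp : IsCoveringMap p) : Function.Injective p := by
  have : Fact (Module.finrank ℝ E3 = 2 + 1) := ⟨by simp⟩
  obtain ⟨a⟩ : Nonempty M := inferInstance
  have key (v : Metric.sphere (0 : E3) 1) (b : M) (hb : p b ≠ v) :
      ∃ s : Metric.sphere (0 : E3) 1 → M, ContinuousOn s {v}ᶜ ∧ (∀ y, y ≠ v → p (s y) = y) ∧
        s (p b) = b := by
    set σ := stereographic (norm_eq_of_mem_sphere v) with hσ
    have hsrc : σ.source = {v}ᶜ := stereographic_source _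
    have hcont : Continuous σ.symm := continuousOn_univ.1 (by simpa [hσ] using σ.continuousOn_symm)
    -- Inverse stereographic projection is defined on a plane, which is simply connected, so it
    -- lifts through the covering.
    obtain ⟨F, ⟨hF, hpF⟩, -⟩ := hp.existsUnique_continuousMap_lifts ⟨σ.symm, hcont⟩ (σ (p b)) b
      (σ.left_inv (by simpa [hsrc] using hb)).symm
    refine ⟨F ∘ σ, ?_, fun y hy ↦ ?_, hF⟩
    · exact F.continuous.comp_continuousOn (hsrc ▸ σ.continuousOn)
    · have := congrFun hpF (σ y)
      simp only [Function.comp_apply, ContinuousMap.coe_mk] at this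
      rw [Function.comp_apply, this, σ.left_inv (by simpa [hsrc] using hy)]
  -- Projecting from the antipode of `p a` puts `p a` in the domain of the first section.
  set v : Metric.sphere (0 : E3) 1 := - p a with hv
  have hne (y : Metric.sphere (0 : E3) 1) : y ≠ -y := ne_neg_of_mem_unit_sphere ℝ y
  have hav : p a ≠ v := hne _
  have hvv : -v ≠ v := fun h ↦ hne v h.symm
  obtain ⟨s₁, hs₁, hps₁, ha₁⟩ := key v a hav
  -- the overlap
  set σ := stereographic (norm_eq_of_mem_sphere v) with hσ
  have hsrc : σ.source = {v}ᶜ := stereographic_source _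
  have hcont : Continuous σ.symm := continuousOn_univ.1 (by simpa [hσ] using σ.continuousOn_symm)
  have hfin : Module.finrank ℝ (ℝ ∙ (v : E3))ᗮ = 2 :=
    Submodule.finrank_orthogonal_span_singleton (by
      intro h; have hy := norm_eq_of_mem_sphere v; simp [h] at hy)
  -- Stereographic projection from `v` sends `-v` to `0`, so the overlap of the two domains is a
  -- punctured plane, which is connected.
  have hconn : IsConnected ({0}ᶜ : Set (ℝ ∙ (v : E3))ᗮ) := by
    refine isConnected_compl_singleton_of_one_lt_rank ?_ 0
    rw [← Module.finrank_eq_rank, hfin]; norm_num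
  have himg : σ.symm '' {0}ᶜ = {v, -v}ᶜ := by
    have h0 : σ (-v) = 0 := stereographic_apply_neg v
    ext y
    constructor
    · rintro ⟨u, hu, rfl⟩
      have hu' : σ (σ.symm u) = u := σ.right_inv (by simp [hσ])
      have h1 : σ.symm u ∈ σ.source := σ.map_target (by simp [hσ])
      rw [hsrc] at h1
      simp only [mem_compl_iff, mem_insert_iff, mem_singleton_iff, not_or] at h1 ⊢
      refine ⟨h1, fun h ↦ hu ?_⟩
      rw [mem_singleton_iff, ← hu', h, h0]
    · intro hy
      simp only [mem_compl_iff, mem_insert_iff, mem_singleton_iff, not_or] at hy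
      have hys : y ∈ σ.source := by rw [hsrc]; exact hy.1
      refine ⟨σ y, fun h ↦ hy.2 ?_, σ.left_inv hys⟩
      rw [mem_singleton_iff, ← h0] at h
      exact σ.injOn hys (by rw [hsrc]; exact hvv) h
  have hS : IsConnected ({v, -v}ᶜ : Set (Metric.sphere (0 : E3) 1)) :=
    himg ▸ hconn.image _ hcont.continuousOn
  obtain ⟨z, hz⟩ := hS.nonempty
  have hz' : z ≠ v ∧ z ≠ -v := by simpa using hz
  -- The second section is made to pass through `s₁ z`; uniqueness of lifts then makes the two agree
  -- on the whole overlap.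
  obtain ⟨s₂, hs₂, hps₂, ha₂⟩ := key (-v) (s₁ z) (by rw [hps₁ z hz'.1]; exact hz'.2)
  rw [hps₁ z hz'.1] at ha₂
  have hagree : EqOn s₁ s₂ {v, -v}ᶜ := by
    refine hp.eqOn_of_comp_eqOn hS.isPreconnected (hs₁.mono ?_) (hs₂.mono ?_) ?_ hz ha₂.symm
    · intro y; simp; tauto
    · intro y; simp
    · intro y hy
      have hy' : y ≠ v ∧ y ≠ -v := by simpa using hy
      simp [hps₁ y hy'.1, hps₂ y hy'.2]
  classical
  set s : Metric.sphere (0 : E3) 1 → M := fun y ↦ if y = v then s₂ y else s₁ y with hs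
  have e₁ : EqOn s s₁ {v}ᶜ := fun y hy ↦ if_neg hy
  have e₂ : EqOn s s₂ {-v}ᶜ := fun y hy ↦ by
    by_cases h : y = v
    · simp [hs, h]
    · rw [e₁ h]; exact hagree (by simp at hy; simp [h, hy])
  have hsc : Continuous s := by
    rw [continuous_iff_continuousAt]
    intro y
    by_cases h : y = v
    · have hy : y ∈ ({-v}ᶜ : Set (Metric.sphere (0 : E3) 1)) := by rw [h]; exact hvv.symm
      exact (hs₂.congr e₂).continuousAt (isOpen_compl_singleton.mem_nhds hy)
    · exact (hs₁.congr e₁).continuousAt (isOpen_compl_singleton.mem_nhds h)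
  have hps (y) : p (s y) = y := by
    by_cases h : y = v
    · rw [e₂ (by rw [h]; exact hvv.symm), hps₂ y (by rw [h]; exact hvv.symm)]
    · rw [e₁ h, hps₁ y h]
  -- Both maps lift `p` through `p` and agree at `a`, so the section `s` is also a left inverse.
  have hid : s ∘ p = id :=
    hp.eq_of_comp_eq (hsc.comp hp.continuous) continuous_id (by ext1 y; simp [hps]) a
      (by simp [e₁ hav, ha₁])
  exact (Function.leftInverse_iff_comp.2 hid).injective

/-! ### Determinants of three vectors. -/

/-- For fixed `z` this is an alternating form on a plane, hence scaled by `det L`. Jacobians of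
chart changes and the curvature `K` both enter through this identity. -/
theorem det3_linear_comp (L : EuclideanSpace ℝ (Fin 2) →ₗ[ℝ] EuclideanSpace ℝ (Fin 2))
    (B : EuclideanSpace ℝ (Fin 2) →ₗ[ℝ] E3) (z : E3) :
    det3 (B (L (EuclideanSpace.single 0 1))) (B (L (EuclideanSpace.single 1 1))) z =
      LinearMap.det L *
        det3 (B (EuclideanSpace.single 0 1)) (B (EuclideanSpace.single 1 1)) z := by
  set b := EuclideanSpace.basisFun (Fin 2) ℝ with hb
  have h (v : EuclideanSpace ℝ (Fin 2)) :
      v = v 0 • EuclideanSpace.single 0 1 + v 1 • EuclideanSpace.single 1 1 := by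
    ext i; fin_cases i <;> simp
  have hdet : LinearMap.det L = L (EuclideanSpace.single 0 1) 0 * L (EuclideanSpace.single 1 1) 1
      - L (EuclideanSpace.single 1 1) 0 * L (EuclideanSpace.single 0 1) 1 := by
    rw [← LinearMap.det_toMatrix b.toBasis, Matrix.det_fin_two]
    simp [LinearMap.toMatrix_apply, hb]
  have hL0 := h (L (EuclideanSpace.single 0 1))
  have hL1 := h (L (EuclideanSpace.single 1 1))
  rw [hdet]
  conv_lhs => rw [hL0, hL1]
  simp only [map_add, map_smul, det3, Module.Basis.det_apply, Matrix.det_fin_three,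
    Module.Basis.toMatrix_apply]
  simp
  ring

theorem continuous_det3 : Continuous fun v : E3 × E3 × E3 ↦ det3 v.1 v.2.1 v.2.2 := by
  simp only [det3, Module.Basis.det_apply, Matrix.det_fin_three, Module.Basis.toMatrix_apply]
  simp
  fun_prop

/-! ### Chart measures and their gluing. -/

section Measure

variable {M : Type*} [TopologicalSpace M] [MeasurableSpace M] [BorelSpace M]

theorem OpenPartialHomeomorph.measurableSet_image {X Y : Type*} [TopologicalSpace X]
    [MeasurableSpace X] [BorelSpace X] [TopologicalSpace Y] [MeasurableSpace Y] [BorelSpace Y]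
    (e : OpenPartialHomeomorph X Y) {A : Set X} (hA : MeasurableSet A) (hs : A ⊆ e.source) :
    MeasurableSet (e '' A) := by
  have h1 : e '' A = (↑) '' ((fun y : e.target ↦ e.symm y) ⁻¹' A) := by
    rw [e.image_eq_target_inter_inv_preimage hs]
    ext y
    simp [and_comm]
  rw [h1]
  exact e.open_target.measurableSet.subtype_image (e.continuousOn_symm.domRestrict.measurable hA)

theorem aemeasurable_symm_chart (e : OpenPartialHomeomorph M (EuclideanSpace ℝ (Fin 2))) :
    AEMeasurable e.symm (volume.restrict e.target) :=
  e.continuousOn_symm.aemeasurable e.open_target.measurableSet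

theorem chartAreaMeasure_apply (f η : M → E3)
    (e : OpenPartialHomeomorph M (EuclideanSpace ℝ (Fin 2))) {A : Set M} (hA : MeasurableSet A)
    (hs : A ⊆ e.source) :
    chartAreaMeasure f η e A = ∫⁻ x in e '' A, ENNReal.ofReal |areaCoefficient f η e x| := by
  rw [chartAreaMeasure, Measure.map_apply_of_aemeasurable
    ((aemeasurable_symm_chart e).mono_ac (withDensity_absolutelyContinuous _ _)) hA,
    withDensity_apply', Measure.restrict_restrict' e.open_target.measurableSet,
    e.image_eq_target_inter_inv_preimage hs, inter_comm]

theorem chartAreaMeasure_compl_source (f η : M → E3)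
    (e : OpenPartialHomeomorph M (EuclideanSpace ℝ (Fin 2))) :
    chartAreaMeasure f η e e.sourceᶜ = 0 := by
  rw [chartAreaMeasure, Measure.map_apply_of_aemeasurable
    ((aemeasurable_symm_chart e).mono_ac (withDensity_absolutelyContinuous _ _))
      e.open_source.measurableSet.compl,
    withDensity_apply', Measure.restrict_restrict' e.open_target.measurableSet]
  have : e.symm ⁻¹' e.sourceᶜ ∩ e.target = ∅ := by
    ext y
    simp only [preimage_compl, mem_inter_iff, mem_compl_iff, mem_preimage, mem_empty_iff_false,
      iff_false, not_and]
    exact fun h1 h2 ↦ h1 (e.map_target h2)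
  rw [this, Measure.restrict_empty, lintegral_zero_measure]

omit [TopologicalSpace M] [BorelSpace M] in
/-- The supremum of a family of measures that agree on overlaps of their domains restricts to each
of them. -/
theorem MeasureTheory.Measure.restrict_biSup_eq {ι : Type*} {S : Set ι} {m : ι → Measure M}
    {s : ι → Set M} (hs : ∀ i ∈ S, MeasurableSet (s i)) (h0 : ∀ i ∈ S, m i (s i)ᶜ = 0)
    (h : ∀ i ∈ S, ∀ j ∈ S, ∀ A, MeasurableSet A → A ⊆ s i ∩ s j → m i A = m j A) {i : ι}
    (hi : i ∈ S) : (⨆ j ∈ S, m j).restrict (s i) = m i := by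
  have hfull (j) (hj : j ∈ S) (B : Set M) : m j B = m j (B ∩ s j) := by
    refine (measure_inter_conull' ?_).symm
    exact measure_mono_null (fun x hx ↦ hx.2) (h0 j hj)
  -- Nothing is known about the other measures outside `s i`, so the upper bound is made infinite on
  -- every measurable set that leaves `s i`; the extra term disappears on restriction to `s i`.
  have hle : (⨆ j ∈ S, m j) ≤ m i + (⊤ : ENNReal) • Measure.count.restrict (s i)ᶜ := by
    refine iSup₂_le fun j hj ↦ Measure.le_iff.2 fun B hB ↦ ?_
    by_cases hBi : B ⊆ s i
    · rw [hfull j hj, h j hj i hi _ (hB.inter (hs j hj)) fun x hx ↦ ⟨hx.2, hBi hx.1⟩]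
      exact (measure_mono inter_subset_left).trans (by simp)
    · obtain ⟨x, hxB, hx⟩ := not_subset.1 hBi
      have h1 : Measure.count.restrict (s i)ᶜ B ≠ 0 := by
        rw [Measure.restrict_apply hB]
        exact Measure.count_ne_zero ⟨x, hxB, hx⟩
      rw [Measure.coe_add, Pi.add_apply, Measure.smul_apply, smul_eq_mul, ENNReal.top_mul h1]
      exact le_add_of_nonneg_of_le (zero_le) le_top
  ext B hB
  rw [Measure.restrict_apply hB]
  refine le_antisymm ?_ ?_
  · refine (hle _).trans ?_
    have : (Measure.count.restrict (s i)ᶜ) (B ∩ s i) = 0 := by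
      rw [Measure.restrict_apply (hB.inter (hs i hi))]
      simp [inter_assoc]
    simp only [Measure.coe_add, Measure.coe_smul, Pi.add_apply, Pi.smul_apply, this, smul_zero,
      add_zero]
    exact measure_mono inter_subset_left
  · rw [hfull i hi]
    exact le_iSup₂ (f := fun j (_ : j ∈ S) ↦ m j) i hi _

omit [BorelSpace M] in
/-- Measures on a compact space are equal if they are equal near each point. -/
theorem MeasureTheory.Measure.ext_of_locally_eq [CompactSpace M] {μ ν : Measure M}
    (h : ∀ p, ∃ U, IsOpen U ∧ p ∈ U ∧ μ.restrict U = ν.restrict U) : μ = ν := by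
  choose U hU hp hr using h
  obtain ⟨t, ht⟩ := CompactSpace.elim_nhds_subcover U fun p ↦ (hU p).mem_nhds (hp p)
  exact (Measure.ext_iff_of_biUnion_eq_univ t.countable_toSet (by simpa using ht)).2
    fun i _ ↦ hr i

end Measure

/-! ### The area measure under changes of charts and parametrizations. -/

section Charts

variable {M : Type*} [TopologicalSpace M] [ChartedSpace (EuclideanSpace ℝ (Fin 2)) M]
  [IsManifold (𝓡 2) ∞ M]
  {M' : Type*} [TopologicalSpace M'] [ChartedSpace (EuclideanSpace ℝ (Fin 2)) M']
  [IsManifold (𝓡 2) ∞ M']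
  {e : OpenPartialHomeomorph M (EuclideanSpace ℝ (Fin 2))}
  {e' : OpenPartialHomeomorph M' (EuclideanSpace ℝ (Fin 2))}
  {x : EuclideanSpace ℝ (Fin 2)}

theorem contMDiffAt_atlas_symm (he : e ∈ atlas (EuclideanSpace ℝ (Fin 2)) M) (hx : x ∈ e.target) :
    ContMDiffAt (𝓡 2) (𝓡 2) ∞ e.symm x :=
  (contMDiffOn_symm_of_mem_maximalAtlas (IsManifold.subset_maximalAtlas he)).contMDiffAt
    (e.open_target.mem_nhds hx)

theorem contMDiffAt_atlas (he : e ∈ atlas (EuclideanSpace ℝ (Fin 2)) M) {p : M}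
    (hp : p ∈ e.source) : ContMDiffAt (𝓡 2) (𝓡 2) ∞ e p :=
  (contMDiffOn_of_mem_maximalAtlas (IsManifold.subset_maximalAtlas he)).contMDiffAt
    (e.open_source.mem_nhds hp)

theorem ContMDiffAt.contDiffAt_comp_atlas_symm
    {F : Type*} [NormedAddCommGroup F] [NormedSpace ℝ F] {f : M → F}
    (he : e ∈ atlas (EuclideanSpace ℝ (Fin 2)) M) (hx : x ∈ e.target)
    (hf : ContMDiffAt (𝓡 2) 𝓘(ℝ, F) ∞ f (e.symm x)) : ContDiffAt ℝ ∞ (f ∘ e.symm) x :=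
  contMDiffAt_iff_contDiffAt.1 (hf.comp x (contMDiffAt_atlas_symm he hx))

theorem ContMDiff.contDiffAt_transition {ψ : M → M'} (hψ : ContMDiff (𝓡 2) (𝓡 2) ∞ ψ)
    (he : e ∈ atlas (EuclideanSpace ℝ (Fin 2)) M)
    (he' : e' ∈ atlas (EuclideanSpace ℝ (Fin 2)) M') (hx : x ∈ e.target)
    (hx' : ψ (e.symm x) ∈ e'.source) : ContDiffAt ℝ ∞ (e' ∘ ψ ∘ e.symm) x :=
  contMDiffAt_iff_contDiffAt.1 <|
    (contMDiffAt_atlas he' hx').comp x ((hψ _).comp x (contMDiffAt_atlas_symm he hx))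

theorem areaCoefficient_comp {ψ : M → M'} (hψ : ContMDiff (𝓡 2) (𝓡 2) ∞ ψ) {f η : M' → E3}
    (hf : ContMDiff (𝓡 2) 𝓘(ℝ, E3) ∞ f)
    (he : e ∈ atlas (EuclideanSpace ℝ (Fin 2)) M)
    (he' : e' ∈ atlas (EuclideanSpace ℝ (Fin 2)) M') (hx : x ∈ e.target)
    (hx' : ψ (e.symm x) ∈ e'.source) :
    areaCoefficient (f ∘ ψ) (η ∘ ψ) e x = (fderiv ℝ (e' ∘ ψ ∘ e.symm) x).det *
      areaCoefficient f η e' (e' (ψ (e.symm x))) := by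
  have hg := (hψ.contDiffAt_transition he he' hx hx').differentiableAt (by simp)
  have hy : e' (ψ (e.symm x)) ∈ e'.target := e'.map_source hx'
  have hf' : DifferentiableAt ℝ (f ∘ e'.symm) ((e' ∘ ψ ∘ e.symm) x) :=
    ((hf _).contDiffAt_comp_atlas_symm he' hy).differentiableAt (by simp)
  have hev : (f ∘ ψ) ∘ e.symm =ᶠ[𝓝 x] (f ∘ e'.symm) ∘ (e' ∘ ψ ∘ e.symm) := by
    have hc : ContinuousAt (ψ ∘ e.symm) x :=
      hψ.continuous.continuousAt.comp (contMDiffAt_atlas_symm he hx).continuousAt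
    filter_upwards [hc.eventually_mem (e'.open_source.mem_nhds hx')] with y hy
    simp only [Function.comp_apply] at hy ⊢
    rw [e'.left_inv hy]
  have hd := hev.fderiv_eq (𝕜 := ℝ)
  rw [fderiv_comp x hf' hg] at hd
  rw [areaCoefficient, areaCoefficient, hd, e'.left_inv hx']
  exact det3_linear_comp (ContinuousLinearMap.toLinearMap (fderiv ℝ (e' ∘ ψ ∘ e.symm) x))
    (ContinuousLinearMap.toLinearMap (fderiv ℝ (f ∘ e'.symm) (e' (ψ (e.symm x))))) _

theorem continuousOn_areaCoefficient {f η : M → E3} (hf : ContMDiff (𝓡 2) 𝓘(ℝ, E3) ∞ f)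
    (hη : Continuous η) (he : e ∈ atlas (EuclideanSpace ℝ (Fin 2)) M) :
    ContinuousOn (areaCoefficient f η e) e.target := by
  intro x hx
  have h1 : ContinuousAt (fderiv ℝ (f ∘ e.symm)) x :=
    (((hf _).contDiffAt_comp_atlas_symm he hx).fderiv_right (m := 0) (by simp)).continuousAt
  have h2 : ContinuousAt (η ∘ e.symm) x :=
    hη.continuousAt.comp (contMDiffAt_atlas_symm he hx).continuousAt
  exact (continuous_det3.continuousAt.comp <| (h1.clm_apply continuousAt_const).prodMk <|
    (h1.clm_apply continuousAt_const).prodMk h2).continuousWithinAt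

variable [MeasurableSpace M] [BorelSpace M] [MeasurableSpace M'] [BorelSpace M']

/-- The Jacobian in the change of variables formula is the factor from `areaCoefficient_comp`.
Taking `ψ` to be the identity gives agreement of chart measures on overlaps; general `ψ` gives
invariance under reparametrization. -/
theorem chartAreaMeasure_image (ψ : M ≃ₜ M') (hψ : ContMDiff (𝓡 2) (𝓡 2) ∞ ψ) {f η : M' → E3}
    (hf : ContMDiff (𝓡 2) 𝓘(ℝ, E3) ∞ f)
    (he : e ∈ atlas (EuclideanSpace ℝ (Fin 2)) M)
    (he' : e' ∈ atlas (EuclideanSpace ℝ (Fin 2)) M') {A : Set M} (hA : MeasurableSet A)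
    (hs : A ⊆ e.source) (hs' : A ⊆ ψ ⁻¹' e'.source) :
    chartAreaMeasure f η e' (ψ '' A) = chartAreaMeasure (f ∘ ψ) (η ∘ ψ) e A := by
  have hmem : ∀ x ∈ e '' A, x ∈ e.target ∧ ψ (e.symm x) ∈ e'.source := by
    rintro _ ⟨p, hp, rfl⟩
    exact ⟨e.map_source (hs hp), by rw [e.left_inv (hs hp)]; exact hs' hp⟩
  have himg : e' '' (ψ '' A) = (e' ∘ ψ ∘ e.symm) '' (e '' A) := by
    rw [image_image, image_image]
    exact image_congr fun p hp ↦ by simp [e.left_inv (hs hp)]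
  have hinj : InjOn (e' ∘ ψ ∘ e.symm) (e '' A) := by
    intro x hx y hy hxy
    exact e.symm.injOn (hmem x hx).1 (hmem y hy).1
      (ψ.injective (e'.injOn (hmem x hx).2 (hmem y hy).2 hxy))
  rw [chartAreaMeasure_apply _ _ _ (ψ.measurableEmbedding.measurableSet_image.2 hA)
      (image_subset_iff.2 hs'), chartAreaMeasure_apply _ _ _ hA hs, himg,
    lintegral_image_eq_lintegral_abs_det_fderiv_mul volume (e.measurableSet_image hA hs)
      (fun x hx ↦ ((hψ.contDiffAt_transition he he' (hmem x hx).1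
        (hmem x hx).2).differentiableAt (by simp)).hasFDerivAt.hasFDerivWithinAt) hinj]
  refine setLIntegral_congr_fun (e.measurableSet_image hA hs) fun x hx ↦ ?_
  rw [areaCoefficient_comp hψ hf he he' (hmem x hx).1 (hmem x hx).2, abs_mul,
    ENNReal.ofReal_mul (abs_nonneg _)]
  rfl

theorem areaMeasure_restrict_source {f η : M → E3} (hf : ContMDiff (𝓡 2) 𝓘(ℝ, E3) ∞ f)
    (he : e ∈ atlas (EuclideanSpace ℝ (Fin 2)) M) :
    (areaMeasure f η).restrict e.source = chartAreaMeasure f η e := by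
  refine Measure.restrict_biSup_eq (S := atlas (EuclideanSpace ℝ (Fin 2)) M)
    (s := fun e ↦ e.source) (fun e _ ↦ e.open_source.measurableSet)
    (fun e _ ↦ chartAreaMeasure_compl_source f η e) (fun e he e' he' A hA hs ↦ ?_) he
  have := chartAreaMeasure_image (Homeomorph.refl M) (η := η) contMDiff_id hf he he' hA
    (fun p hp ↦ (hs hp).1) (fun p hp ↦ (hs hp).2)
  simpa using this.symm

theorem areaMeasure_apply_of_subset_source {f η : M → E3} (hf : ContMDiff (𝓡 2) 𝓘(ℝ, E3) ∞ f)
    (he : e ∈ atlas (EuclideanSpace ℝ (Fin 2)) M) {A : Set M} (hs : A ⊆ e.source) :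
    areaMeasure f η A = chartAreaMeasure f η e A := by
  rw [← areaMeasure_restrict_source hf he, Measure.restrict_eq_self _ hs]

/-- The area of a surface is invariant under reparametrization. -/
theorem areaMeasure_univ_comp [CompactSpace M] (ψ : M ≃ₜ M') (hψ : ContMDiff (𝓡 2) (𝓡 2) ∞ ψ)
    {f η : M' → E3} (hf : ContMDiff (𝓡 2) 𝓘(ℝ, E3) ∞ f) :
    areaMeasure (f ∘ ψ) (η ∘ ψ) univ = areaMeasure f η univ := by
  have h : areaMeasure (f ∘ ψ) (η ∘ ψ) = (areaMeasure f η).comap ψ := by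
    refine Measure.ext_of_locally_eq fun p ↦ ?_
    set e := chartAt (EuclideanSpace ℝ (Fin 2)) p
    set e' := chartAt (EuclideanSpace ℝ (Fin 2)) (ψ p)
    refine ⟨e.source ∩ ψ ⁻¹' e'.source, e.open_source.inter (e'.open_source.preimage ψ.continuous),
      ⟨mem_chart_source _ _, mem_chart_source _ _⟩, ?_⟩
    ext A hA
    have hU : MeasurableSet (A ∩ (e.source ∩ ψ ⁻¹' e'.source)) := hA.inter
      (e.open_source.inter (e'.open_source.preimage ψ.continuous)).measurableSet
    rw [Measure.restrict_apply hA, Measure.restrict_apply hA,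
      ψ.measurableEmbedding.comap_apply,
      areaMeasure_apply_of_subset_source (hf.comp hψ) (chart_mem_atlas _ p) (fun q hq ↦ hq.2.1),
      areaMeasure_apply_of_subset_source hf (chart_mem_atlas _ (ψ p)) (image_subset_iff.2
        fun q hq ↦ hq.2.2),
      chartAreaMeasure_image ψ hψ hf (chart_mem_atlas _ p) (chart_mem_atlas _ (ψ p)) hU
        (fun q hq ↦ hq.2.1) (fun q hq ↦ hq.2.2)]
  rw [h, ψ.measurableEmbedding.comap_apply, image_univ, ψ.surjective.range_eq]

/-- Applied to `∂B`, this gives the integrability of `K` and ensures that the real-valued area is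
not the default value of an infinite measure. The density is locally bounded, so the measure is
locally finite, and compactness finishes. -/
theorem isFiniteMeasure_areaMeasure [CompactSpace M] {f η : M → E3}
    (hf : ContMDiff (𝓡 2) 𝓘(ℝ, E3) ∞ f) (hη : Continuous η) :
    IsFiniteMeasure (areaMeasure f η) := by
  have hfin : IsLocallyFiniteMeasure (areaMeasure f η) := by
    refine ⟨fun p ↦ ?_⟩
    set e := chartAt (EuclideanSpace ℝ (Fin 2)) p with he
    have hat := chart_mem_atlas (EuclideanSpace ℝ (Fin 2)) p
    have hp : e p ∈ e.target := e.map_source (mem_chart_source _ _)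
    obtain ⟨s, hs, hK⟩ : ∃ s ∈ 𝓝 (e p), ∀ y ∈ s, |areaCoefficient f η e y| <
        |areaCoefficient f η e (e p)| + 1 ∧ y ∈ e.target ∧ y ∈ Metric.ball (e p) 1 := by
      have hc := ((continuousOn_areaCoefficient hf hη hat).continuousAt
        (e.open_target.mem_nhds hp)).abs
      exact ⟨_, Filter.inter_mem (hc.eventually (gt_mem_nhds (lt_add_one _))) (Filter.inter_mem
        (e.open_target.mem_nhds hp) (Metric.ball_mem_nhds _ one_pos)), fun y hy ↦ hy⟩
    obtain ⟨t, hts, ht, hpt⟩ := mem_nhds_iff.1 hs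
    have hA : IsOpen (e.source ∩ e ⁻¹' t) := e.isOpen_inter_preimage ht
    refine ⟨e.source ∩ e ⁻¹' t, hA.mem_nhds ⟨mem_chart_source _ _, hpt⟩, ?_⟩
    have himg : e '' (e.source ∩ e ⁻¹' t) ⊆ t := by
      rintro _ ⟨q, hq, rfl⟩
      exact hq.2
    rw [areaMeasure_apply_of_subset_source hf hat inter_subset_left,
      chartAreaMeasure_apply _ _ _ hA.measurableSet inter_subset_left]
    refine (lintegral_mono_set himg).trans_lt ?_
    refine (setLIntegral_mono measurable_const fun y hy ↦
      ENNReal.ofReal_le_ofReal (hK y (hts hy)).1.le).trans_lt ?_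
    rw [setLIntegral_const]
    exact ENNReal.mul_lt_top ENNReal.ofReal_lt_top <|
      (measure_mono fun y hy ↦ (hK y (hts hy)).2.2).trans_lt measure_ball_lt_top
  infer_instance

end Charts

/-! ### Cross products and normals to a plane. -/

/-- The functional `l` vanishes on the plane but not at `z`, so `z` is transversal to the plane. -/
theorem det3_ne_zero {B : EuclideanSpace ℝ (Fin 2) →ₗ[ℝ] E3} (hB : Function.Injective B)
    {l : E3 →ₗ[ℝ] ℝ} (hl : ∀ v, l (B v) = 0) {z : E3} (hz : l z ≠ 0) :
    det3 (B (EuclideanSpace.single 0 1)) (B (EuclideanSpace.single 1 1)) z ≠ 0 := by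
  have hli : LinearIndependent ℝ
      ![B (EuclideanSpace.single 0 1), B (EuclideanSpace.single 1 1), z] := by
    rw [Fintype.linearIndependent_iff]
    intro g hg
    simp only [Fin.sum_univ_three, Matrix.cons_val_zero, Matrix.cons_val_one,
      Matrix.cons_val_two] at hg
    have h2 : g 2 = 0 := by
      have := congrArg l hg
      simpa [hl, hz] using this
    have h01 : g 0 • EuclideanSpace.single 0 1 + g 1 • EuclideanSpace.single 1 1 =
        (0 : EuclideanSpace ℝ (Fin 2)) := by
      apply hB
      simpa [h2] using hg
    have h0 := congrArg (fun v ↦ v 0) h01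
    have h1 := congrArg (fun v ↦ v 1) h01
    simp at h0 h1
    intro i
    fin_cases i <;> assumption
  have hunit := ((EuclideanSpace.basisFun (Fin 3) ℝ).toBasis.is_basis_iff_det
    (v := ![B (EuclideanSpace.single 0 1), B (EuclideanSpace.single 1 1), z])).1
    ⟨hli, hli.span_eq_top_of_card_eq_finrank (by simp)⟩
  exact hunit.ne_zero

/-- The cross product of two vectors of `ℝ³`. -/
def cross3 (a b : E3) : E3 :=
  ∑ i, det3 a b (EuclideanSpace.single i 1) • EuclideanSpace.single i 1

theorem inner_cross3 (a b z : E3) : inner ℝ (cross3 a b) z = det3 a b z := by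
  simp only [cross3, det3, Module.Basis.det_apply, Matrix.det_fin_three,
    Module.Basis.toMatrix_apply, PiLp.inner_apply, Fin.sum_univ_three]
  simp
  ring

theorem contDiff_cross3 : ContDiff ℝ ∞ fun v : E3 × E3 ↦ cross3 v.1 v.2 := by
  simp only [cross3, det3, Module.Basis.det_apply, Matrix.det_fin_three,
    Module.Basis.toMatrix_apply, Fin.sum_univ_three]
  simp
  have h (i : Fin 3) : ContDiff ℝ ∞ fun v : E3 ↦ v i := contDiff_euclidean.1 contDiff_id i
  have h1 (i : Fin 3) : ContDiff ℝ ∞ fun v : E3 × E3 ↦ v.1 i := (h i).comp contDiff_fst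
  have h2 (i : Fin 3) : ContDiff ℝ ∞ fun v : E3 × E3 ↦ v.2 i := (h i).comp contDiff_snd
  fun_prop

attribute [irreducible] cross3

/-- A unit vector orthogonal to the range of an injective linear map `ℝ² → ℝ³` is a normalized
cross product, up to sign. -/
theorem eq_smul_cross3 {B : EuclideanSpace ℝ (Fin 2) →ₗ[ℝ] E3} (hB : Function.Injective B)
    {n : E3} (hn : ‖n‖ = 1) (h : ∀ v, inner ℝ n (B v) = 0) {c : E3}
    (hc : c = cross3 (B (EuclideanSpace.single 0 1)) (B (EuclideanSpace.single 1 1))) :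
    c ≠ 0 ∧ c = inner ℝ c n • n := by
  have hnn : inner ℝ n n = (1 : ℝ) := by rw [real_inner_self_eq_norm_sq, hn, one_pow]
  have hn0 : n ≠ 0 := fun h0 ↦ by simp [h0] at hn
  have h' : ∀ v, (innerₛₗ ℝ n) (B v) = 0 := h
  have hdet : inner ℝ c n ≠ 0 := by
    rw [hc, inner_cross3]
    exact det3_ne_zero hB h' (hnn.trans_ne one_ne_zero)
  refine ⟨fun h0 ↦ hdet (by simp [h0]), ?_⟩
  -- The part of `c` orthogonal to `n` is also orthogonal to the range of `B`; these two span the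
  -- space, so `d` is orthogonal to itself.
  set d := c - inner ℝ c n • n with hd
  have hdn : inner ℝ d n = 0 := by
    rw [hd, inner_sub_left, inner_smul_left, hnn]; simp
  have hperp (v) : inner ℝ c (B v) = 0 := by
    have hv : v = v 0 • EuclideanSpace.single 0 1 + v 1 • EuclideanSpace.single 1 1 := by
      ext i; fin_cases i <;> simp
    rw [hv, map_add, map_smul, map_smul, inner_add_right, inner_smul_right, inner_smul_right,
      hc, inner_cross3, inner_cross3]
    have e1 (a b : E3) : det3 a b a = 0 :=
      AlternatingMap.map_eq_zero_of_eq _ _ (i := 0) (j := 2) rfl (by decide)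
    have e2 (a b : E3) : det3 a b b = 0 :=
      AlternatingMap.map_eq_zero_of_eq _ _ (i := 1) (j := 2) rfl (by decide)
    simp [e1, e2]
  have hdB (v) : inner ℝ d (B v) = 0 := by
    rw [hd, inner_sub_left, inner_smul_left, h, hperp]; simp
  have hinf : LinearMap.range B ⊓ Submodule.span ℝ {n} = ⊥ := by
    rw [eq_bot_iff]
    rintro z ⟨⟨v, rfl⟩, hz⟩
    obtain ⟨s, hs⟩ := Submodule.mem_span_singleton.1 hz
    have := h v
    rw [← hs, inner_smul_right, hnn, mul_one] at this
    rw [Submodule.mem_bot, ← hs, this, zero_smul]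
  have hsup : LinearMap.range B ⊔ Submodule.span ℝ {n} = ⊤ := by
    apply Submodule.eq_top_of_finrank_eq
    have := Submodule.finrank_sup_add_finrank_inf_eq (LinearMap.range B) (Submodule.span ℝ {n})
    rw [hinf, LinearMap.finrank_range_of_inj hB, finrank_span_singleton hn0] at this
    simpa using this
  obtain ⟨_, ⟨v, rfl⟩, _, hz, hvs⟩ := Submodule.mem_sup.1
    (hsup ▸ Submodule.mem_top : d ∈ LinearMap.range B ⊔ Submodule.span ℝ {n})
  obtain ⟨s, rfl⟩ := Submodule.mem_span_singleton.1 hz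
  refine sub_eq_zero.1 (inner_self_eq_zero (𝕜 := ℝ).1 ?_)
  rw [← hd]
  nth_rewrite 2 [← hvs]
  rw [inner_add_right, inner_smul_right, hdB, hdn, mul_zero, add_zero]

/-! ### The norm and its Euclidean Gauss map -/

section Norm

variable {N : Seminorm ℝ E3} {x : E3}

theorem IsMinkowskiNorm.contDiffAt (hN : IsMinkowskiNorm N) (hx : x ≠ 0) : ContDiffAt ℝ ∞ N x :=
  hN.smooth.contDiffAt (isOpen_compl_singleton.mem_nhds hx)

theorem IsMinkowskiNorm.differentiableAt (hN : IsMinkowskiNorm N) (hx : x ≠ 0) :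
    DifferentiableAt ℝ N x :=
  (hN.contDiffAt hx).differentiableAt (by simp)

theorem ne_zero_of_seminorm_eq_one (hx : N x = 1) : x ≠ 0 := fun h ↦ by simp [h] at hx

/-- Euler's identity. -/
theorem IsMinkowskiNorm.fderiv_self (hN : IsMinkowskiNorm N) (hx : x ≠ 0) :
    fderiv ℝ N x x = N x := by
  have h1 : HasDerivAt (fun t : ℝ ↦ N (t • x)) (fderiv ℝ N x x) 1 := by
    have h2 : HasDerivAt (fun t : ℝ ↦ t • x) x 1 := by
      simpa using (hasDerivAt_id (1 : ℝ)).smul_const x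
    have h3 : HasFDerivAt N (fderiv ℝ N x) ((1 : ℝ) • x) := by
      rw [one_smul]; exact (hN.differentiableAt hx).hasFDerivAt
    exact h3.comp_hasDerivAt 1 h2
  have h4 : HasDerivAt (fun t : ℝ ↦ N (t • x)) (N x) 1 := by
    have : HasDerivAt (fun t : ℝ ↦ t * N x) (N x) 1 := by
      simpa using (hasDerivAt_id (1 : ℝ)).mul_const (N x)
    refine this.congr_of_eventuallyEq ?_
    filter_upwards [lt_mem_nhds (zero_lt_one (α := ℝ))] with t ht
    rw [map_smul_eq_mul, Real.norm_of_nonneg ht.le]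
  exact h1.unique h4

theorem inner_gradient (N : E3 → ℝ) (x v : E3) : inner ℝ (gradient N x) v = fderiv ℝ N x v := by
  simp [gradient]

theorem IsMinkowskiNorm.gradient_ne_zero (hN : IsMinkowskiNorm N) (hx : x ≠ 0) :
    gradient N x ≠ 0 := fun h ↦ by
  have := inner_gradient N x x
  rw [h, inner_zero_left, hN.fderiv_self hx] at this
  exact hx (hN.eq_zero_of_apply_eq_zero x this.symm)

theorem IsMinkowskiNorm.contDiffAt_euclideanGaussMap (hN : IsMinkowskiNorm N) (hx : x ≠ 0) :
    ContDiffAt ℝ ∞ (euclideanGaussMap N) x := by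
  have h1 : ContDiffAt ℝ ∞ (gradient N) x :=
    (InnerProductSpace.toDual ℝ E3).symm.toContinuousLinearEquiv.contDiff.contDiffAt.comp x
      ((hN.contDiffAt hx).fderiv_right (m := ∞) (by simp))
  exact ((h1.norm ℝ (hN.gradient_ne_zero hx)).inv
    (norm_ne_zero_iff.2 (hN.gradient_ne_zero hx))).smul h1

theorem IsMinkowskiNorm.norm_euclideanGaussMap (hN : IsMinkowskiNorm N) (hx : x ≠ 0) :
    ‖euclideanGaussMap N x‖ = 1 := by
  have := norm_ne_zero_iff.2 (hN.gradient_ne_zero hx)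
  rw [euclideanGaussMap, norm_smul, norm_inv, norm_norm, inv_mul_cancel₀ this]

theorem inner_euclideanGaussMap_eq_zero {v : E3} (h : fderiv ℝ N x v = 0) :
    inner ℝ (euclideanGaussMap N x) v = 0 := by
  rw [euclideanGaussMap, inner_smul_left, inner_gradient, h, mul_zero]

/-- The homogeneous extension of the Gauss map of the unit sphere is a local diffeomorphism, as
the Gaussian curvature does not vanish. -/
theorem IsMinkowskiNorm.fderiv_smul_euclideanGaussMap_injective (hN : IsMinkowskiNorm N)
    (hx : N x = 1) :
    Function.Injective (fderiv ℝ (fun y ↦ N y • euclideanGaussMap N y) x) := by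
  have hx0 := ne_zero_of_seminorm_eq_one hx
  have hn := (hN.contDiffAt_euclideanGaussMap hx0).differentiableAt (by simp)
  have hd (v) : fderiv ℝ (fun y ↦ N y • euclideanGaussMap N y) x v =
      fderiv ℝ (euclideanGaussMap N) x v + fderiv ℝ N x v • euclideanGaussMap N x := by
    rw [fderiv_fun_smul (hN.differentiableAt hx0) hn]
    simp [hx]
  -- Differentiate `‖n‖ ^ 2 = 1`. The two summands in `hd` are therefore orthogonal and vanish
  -- separately.
  have hperp (v) : inner ℝ (euclideanGaussMap N x) (fderiv ℝ (euclideanGaussMap N) x v) = 0 := by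
    have h1 : (fun y ↦ ‖euclideanGaussMap N y‖ ^ 2) =ᶠ[𝓝 x] fun _ ↦ 1 := by
      filter_upwards [isOpen_compl_singleton.mem_nhds hx0] with y hy
      rw [hN.norm_euclideanGaussMap hy, one_pow]
    have h2 := h1.fderiv_eq (𝕜 := ℝ)
    have h3 := hn.hasFDerivAt.norm_sq.fderiv
    rw [h3] at h2
    have := congrArg (fun L ↦ L v) h2
    simpa using this
  rw [injective_iff_map_eq_zero]
  intro v hv
  rw [hd] at hv
  have hv0 : fderiv ℝ N x v = 0 := by
    have := congrArg (fun z ↦ inner ℝ (euclideanGaussMap N x) z) hv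
    simpa [inner_add_right, hperp, inner_smul_right, hN.norm_euclideanGaussMap hx0] using this
  rw [hv0, zero_smul, add_zero] at hv
  have hK := hN.curvature_ne_zero x hx
  rw [unitSphereEuclideanGaussCurvature, tangentialDet] at hK
  -- The vector `v` is now tangent and killed by the differential of the Gauss map, which the
  -- nonzero curvature excludes unless `v = 0`.
  have hinj := (LinearMap.equivOfDetNeZero _ hK).injective
  have : (⟨v, hv0⟩ : (fderiv ℝ N x).ker) = 0 := by
    apply hinj
    simp [LinearMap.equivOfDetNeZero, hv]
  exact congrArg Subtype.val this

/-- A unit normal field along a parametrized surface is smooth if it is continuous at the point. -/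
theorem contDiffAt_unit_normal {F n : EuclideanSpace ℝ (Fin 2) → E3}
    {x : EuclideanSpace ℝ (Fin 2)} (hF : ContDiffAt ℝ ∞ F x) (hnc : ContinuousAt n x)
    (hn1 : ∀ᶠ y in 𝓝 x, ‖n y‖ = 1) (hinj : ∀ᶠ y in 𝓝 x, Function.Injective (fderiv ℝ F y))
    (hperp : ∀ᶠ y in 𝓝 x, ∀ v, inner ℝ (n y) (fderiv ℝ F y v) = 0) : ContDiffAt ℝ ∞ n x := by
  set c : EuclideanSpace ℝ (Fin 2) → E3 := fun y ↦ cross3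
    (fderiv ℝ F y (EuclideanSpace.single 0 1)) (fderiv ℝ F y (EuclideanSpace.single 1 1)) with hc
  have hFd : ContDiffAt ℝ ∞ (fderiv ℝ F) x := hF.fderiv_right (by simp)
  have hcc : ContDiffAt ℝ ∞ c x :=
    contDiff_cross3.contDiffAt.comp x ((hFd.clm_apply contDiffAt_const).prodMk
      (hFd.clm_apply contDiffAt_const))
  have hcn : ∀ᶠ y in 𝓝 x, c y ≠ 0 ∧ c y = inner ℝ (c y) (n y) • n y := by
    filter_upwards [hn1, hinj, hperp] with y hy1 hy2 hy3
    exact eq_smul_cross3 (B := ContinuousLinearMap.toLinearMap (fderiv ℝ F y)) hy2 hy1 hy3 rfl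
  have hsc : ContinuousAt (fun y ↦ inner ℝ (c y) (n y)) x := hcc.continuousAt.inner hnc
  have hs0 : inner ℝ (c x) (n x) ≠ 0 := fun h ↦ by
    have := hcn.self_of_nhds
    rw [h, zero_smul] at this
    exact this.1 this.2
  have habs : ∀ᶠ y in 𝓝 x, |inner ℝ (c y) (n y)| = ‖c y‖ := by
    filter_upwards [hcn, hn1] with y hy hy1
    conv_rhs => rw [hy.2, norm_smul, hy1,
      mul_one, Real.norm_eq_abs]
  -- The normal is plus or minus the normalized cross product; continuity of `n` at `x` keeps the
  -- sign constant nearby.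
  obtain ⟨σ, hσ⟩ : ∃ σ : ℝ, ∀ᶠ y in 𝓝 x, n y = (σ * ‖c y‖)⁻¹ • c y := by
    have key (y) (hy : c y ≠ 0 ∧ c y = inner ℝ (c y) (n y) • n y) (τ : ℝ)
        (hτ : inner ℝ (c y) (n y) = τ) : n y = τ⁻¹ • c y := by
      have h0 : τ ≠ 0 := fun h ↦ by
        rw [hτ, h, zero_smul] at hy
        exact hy.1 hy.2
      conv_rhs => rw [hy.2, hτ]
      rw [smul_smul, inv_mul_cancel₀ h0, one_smul]
    rcases lt_or_gt_of_ne hs0 with hneg | hpos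
    · refine ⟨-1, ?_⟩
      filter_upwards [hcn, habs, hsc.eventually (gt_mem_nhds hneg)] with y hy ha hlt
      refine key y hy _ ?_
      rw [← ha, abs_of_neg hlt]; ring
    · refine ⟨1, ?_⟩
      filter_upwards [hcn, habs, hsc.eventually (lt_mem_nhds hpos)] with y hy ha hlt
      refine key y hy _ ?_
      rw [← ha, abs_of_pos hlt]; ring
  have hcx := hcn.self_of_nhds.1
  have hσ0 : σ ≠ 0 := fun h ↦ by
    have h2 := hn1.self_of_nhds
    rw [hσ.self_of_nhds, h] at h2
    simp at h2
  have hν : ContDiffAt ℝ ∞ (fun y ↦ (σ * ‖c y‖)⁻¹ • c y) x :=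
    ((contDiffAt_const.mul (hcc.norm ℝ hcx)).inv
      (mul_ne_zero hσ0 (norm_ne_zero_iff.2 hcx))).smul hcc
  exact hν.congr_of_eventuallyEq hσ

/-- The unit vectors of a smooth norm that are Birkhoff orthogonal to the tangent planes of a
smooth surface depend smoothly on the point, as soon as they depend continuously on it. -/
theorem IsMinkowskiNorm.contDiffAt_of_tangent (hN : IsMinkowskiNorm N)
    {F H : EuclideanSpace ℝ (Fin 2) → E3} {x : EuclideanSpace ℝ (Fin 2)} (hF : ContDiffAt ℝ ∞ F x)
    (hH : ContinuousAt H x) (h1 : ∀ᶠ y in 𝓝 x, N (H y) = 1)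
    (hinj : ∀ᶠ y in 𝓝 x, Function.Injective (fderiv ℝ F y))
    (hperp : ∀ᶠ y in 𝓝 x, ∀ v, fderiv ℝ N (H y) (fderiv ℝ F y v) = 0) : ContDiffAt ℝ ∞ H x := by
  have hx1 := h1.self_of_nhds
  have hx0 := ne_zero_of_seminorm_eq_one hx1
  have hν : ContDiffAt ℝ ∞ (fun y ↦ euclideanGaussMap N (H y)) x := by
    refine contDiffAt_unit_normal hF
      (ContinuousAt.comp (g := euclideanGaussMap N) (f := H)
        (hN.contDiffAt_euclideanGaussMap hx0).continuousAt hH) ?_ hinj ?_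
    · filter_upwards [h1] with y hy
      exact hN.norm_euclideanGaussMap (ne_zero_of_seminorm_eq_one hy)
    · filter_upwards [hperp] with y hy v
      exact inner_euclideanGaussMap_eq_zero (hy v)
  -- As `N (H y) = 1`, the map `Φ` sends `H y` to the Euclidean normal, already known to be smooth;
  -- a local inverse of `Φ` returns `H`, and continuity of `H` keeps `H y` where that inverse is
  -- valid.
  set Φ : E3 → E3 := fun y ↦ N y • euclideanGaussMap N y with hΦ
  have hΦc : ContDiffAt ℝ ∞ Φ (H x) :=
    (hN.contDiffAt hx0).smul (hN.contDiffAt_euclideanGaussMap hx0)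
  have hΦi : Function.Injective (fderiv ℝ Φ (H x)) :=
    hN.fderiv_smul_euclideanGaussMap_injective hx1
  let L : E3 ≃L[ℝ] E3 := (LinearEquiv.ofInjectiveEndo
    (ContinuousLinearMap.toLinearMap (fderiv ℝ Φ (H x))) hΦi).toContinuousLinearEquiv
  have hL : HasFDerivAt Φ (L : E3 →L[ℝ] E3) (H x) := by
    have : (L : E3 →L[ℝ] E3) = fderiv ℝ Φ (H x) := by ext1 v; rfl
    rw [this]
    exact (hΦc.differentiableAt (by simp)).hasFDerivAt
  have hinv : ∀ᶠ y in 𝓝 x, hΦc.localInverse hL (by simp) (Φ (H y)) = H y :=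
    hH.eventually (hΦc.hasStrictFDerivAt' hL (by simp)).eventually_left_inverse
  have hΦH : ∀ᶠ y in 𝓝 x, Φ (H y) = euclideanGaussMap N (H y) := by
    filter_upwards [h1] with y hy1
    rw [hΦ]
    simp only [hy1, one_smul]
  have hcomp : ContDiffAt ℝ ∞ (fun y ↦ hΦc.localInverse hL (by simp) (euclideanGaussMap N (H y))) x := by
    refine ContDiffAt.comp x ?_ hν
    rw [← hΦH.self_of_nhds]
    exact hΦc.to_localInverse hL (by simp)
  refine hcomp.congr_of_eventuallyEq ?_
  filter_upwards [hinv, hΦH] with y hy hy2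
  rw [← hy2, hy]

end Norm

/-! ### The differential of the Birkhoff-Gauss map and the curvature. -/

section Geometry

variable {M : Type*} [TopologicalSpace M] [ChartedSpace (EuclideanSpace ℝ (Fin 2)) M]
  {N : Seminorm ℝ E3} {f η : M → E3}
  {e : OpenPartialHomeomorph M (EuclideanSpace ℝ (Fin 2))} {p : M}

/-- In a chart, the differentials of maps `M → ℝ³` are their manifold differentials composed with
one linear isomorphism. -/
theorem exists_fderiv_comp_symm_eq (he : e ∈ IsManifold.maximalAtlas (𝓡 2) ∞ M)
    (hp : p ∈ e.source) : ∃ L : EuclideanSpace ℝ (Fin 2) ≃ₗ[ℝ] TangentSpace (𝓡 2) p,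
      ∀ g : M → E3, MDifferentiableAt (𝓡 2) 𝓘(ℝ, E3) g p →
        ∀ v, fderiv ℝ (g ∘ e.symm) (e p) v = mvfderiv (𝓡 2) g p (L v) := by
  have hd : e.MDifferentiable (𝓡 2) (𝓡 2) :=
    ⟨(contMDiffOn_of_mem_maximalAtlas he).mdifferentiableOn (by simp),
      (contMDiffOn_symm_of_mem_maximalAtlas he).mdifferentiableOn (by simp)⟩
  have key (x) (hx : x ∈ e.target) :
      ∃ L : EuclideanSpace ℝ (Fin 2) ≃ₗ[ℝ] TangentSpace (𝓡 2) (e.symm x),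
        ∀ g : M → E3, MDifferentiableAt (𝓡 2) 𝓘(ℝ, E3) g (e.symm x) →
          ∀ v, fderiv ℝ (g ∘ e.symm) x v = mvfderiv (𝓡 2) g (e.symm x) (L v) := by
    refine ⟨(hd.symm.mfderiv hx).toLinearEquiv, fun g hg v ↦ ?_⟩
    have h := mfderiv_comp x hg (hd.symm.mdifferentiableAt hx)
    rw [mfderiv_eq_fderiv] at h
    exact congrArg (fun A ↦ A v) h
  have := key (e p) (e.map_source hp)
  rwa [e.left_inv hp] at this

/-- In adapted charts an immersion is a linear inclusion; by the chain rule a vector killed by `df`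
would be killed by that inclusion. -/
theorem Manifold.IsImmersionAt.mvfderiv_injective
    (hf : Manifold.IsImmersionAt (𝓡 2) 𝓘(ℝ, E3) ∞ f p) :
    Function.Injective (mvfderiv (𝓡 2) f p) := by
  have hp := hf.mem_domChart_source
  set φ := hf.domChart
  obtain ⟨L, hL⟩ := exists_fderiv_comp_symm_eq hf.domChart_mem_maximalAtlas hp
  have hx : φ p ∈ φ.target := φ.map_source hp
  have hfd : MDifferentiableAt (𝓡 2) 𝓘(ℝ, E3) f p := hf.contMDiffAt.mdifferentiableAt (by simp)
  have hFd : DifferentiableAt ℝ (f ∘ φ.symm) (φ p) := by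
    have h1 : MDifferentiableAt (𝓡 2) (𝓡 2) φ.symm (φ p) :=
      ((contMDiffOn_symm_of_mem_maximalAtlas hf.domChart_mem_maximalAtlas).contMDiffAt
        (φ.open_target.mem_nhds hx)).mdifferentiableAt (by simp)
    have h2 : MDifferentiableAt (𝓡 2) 𝓘(ℝ, E3) f (φ.symm (φ p)) := by rwa [φ.left_inv hp]
    exact mdifferentiableAt_iff_differentiableAt.1 (h2.comp _ h1)
  have hcd : DifferentiableAt ℝ hf.codChart ((f ∘ φ.symm) (φ p)) := by
    rw [Function.comp_apply, φ.left_inv hp]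
    exact (contMDiffAt_iff_contDiffAt.1
      ((contMDiffOn_of_mem_maximalAtlas hf.codChart_mem_maximalAtlas).contMDiffAt
        (hf.codChart.open_source.mem_nhds hf.mem_codChart_source))).differentiableAt (by simp)
  have hev : hf.codChart ∘ (f ∘ φ.symm) =ᶠ[𝓝 (φ p)]
      hf.equiv ∘ fun y : EuclideanSpace ℝ (Fin 2) ↦ (y, (0 : hf.complement)) := by
    filter_upwards [φ.open_target.mem_nhds hx] with y hy
    have hy' : y ∈ (φ.extend (𝓡 2)).target := by
      simpa [OpenPartialHomeomorph.extend_target] using hy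
    simpa using hf.writtenInCharts hy'
  have hder := hev.fderiv_eq (𝕜 := ℝ)
  rw [fderiv_comp _ hcd hFd] at hder
  set i : EuclideanSpace ℝ (Fin 2) →L[ℝ] EuclideanSpace ℝ (Fin 2) × hf.complement :=
    ContinuousLinearMap.inl ℝ _ _
  have hR : HasFDerivAt (hf.equiv ∘ fun y : EuclideanSpace ℝ (Fin 2) ↦ (y, (0 : hf.complement)))
      (hf.equiv.toContinuousLinearMap ∘L i) (φ p) :=
    (hf.equiv.toContinuousLinearMap ∘L i).hasFDerivAt
  rw [hR.fderiv] at hder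
  rw [injective_iff_map_eq_zero]
  intro v hv
  have h0 := congrArg (fun A ↦ A (L.symm v)) hder
  have h1 := hL f hfd (L.symm v)
  rw [L.apply_symm_apply, hv] at h1
  have h2 : i (L.symm v) = 0 :=
    hf.equiv.injective <| h0.symm.trans <|
      (congrArg (fderiv ℝ hf.codChart ((f ∘ φ.symm) (φ p))) h1).trans <|
        (map_zero _).trans (map_zero hf.equiv).symm
  have h3 : L.symm v = 0 := congrArg Prod.fst h2
  simpa using h3

/-- Birkhoff orthogonality says that `t ↦ N (η p + t • w)` is minimal at `0`, so its derivative
vanishes there. -/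
theorem IsBirkhoffGaussMap.fderiv_eq_zero (hN : IsMinkowskiNorm N)
    (hη : IsBirkhoffGaussMap N f η) (p : M) (v : TangentSpace (𝓡 2) p) :
    fderiv ℝ N (η p) (mvfderiv (𝓡 2) f p v) = 0 := by
  set w := mvfderiv (𝓡 2) f p v with hw
  have hd := (hN.differentiableAt (ne_zero_of_seminorm_eq_one (hη.unit p))).hasFDerivAt
  have h2 : HasDerivAt (fun t : ℝ ↦ η p + t • w) w 0 := by
    simpa using ((hasDerivAt_id (0 : ℝ)).smul_const w).const_add (η p)
  have h3 : HasFDerivAt N (fderiv ℝ N (η p)) (η p + (0 : ℝ) • w) := by simpa using hd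
  refine IsLocalMin.hasDerivAt_eq_zero (Filter.Eventually.of_forall fun t ↦ ?_)
    (h3.comp_hasDerivAt 0 h2)
  simpa using hη.orthogonal p w ⟨v, rfl⟩ t

variable [IsManifold (𝓡 2) ∞ M]

theorem IsBirkhoffGaussMap.contMDiff (hN : IsMinkowskiNorm N)
    (hf : Manifold.IsImmersion (𝓡 2) 𝓘(ℝ, E3) ∞ f) (hη : IsBirkhoffGaussMap N f η) :
    ContMDiff (𝓡 2) 𝓘(ℝ, E3) ∞ η := by
  intro p
  set e := chartAt (EuclideanSpace ℝ (Fin 2)) p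
  have hat : e ∈ atlas (EuclideanSpace ℝ (Fin 2)) M := chart_mem_atlas _ p
  have hp : p ∈ e.source := mem_chart_source _ p
  have hx : e p ∈ e.target := e.map_source hp
  have hmax := IsManifold.subset_maximalAtlas (I := 𝓡 2) (n := ∞) hat
  have hL (y) (hy : y ∈ e.target) : Function.Injective (fderiv ℝ (f ∘ e.symm) y) ∧
      ∀ v, fderiv ℝ N ((η ∘ e.symm) y) (fderiv ℝ (f ∘ e.symm) y v) = 0 := by
    obtain ⟨L, hL⟩ := exists_fderiv_comp_symm_eq hmax (e.map_target hy)
    rw [e.right_inv hy] at hL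
    have hL' := hL f ((hf.contMDiff _).mdifferentiableAt (by simp))
    refine ⟨fun v w hvw ↦ ?_, fun v ↦ ?_⟩
    · rw [hL', hL'] at hvw
      exact L.injective ((hf.isImmersionAt _).mvfderiv_injective hvw)
    · rw [hL']
      exact hη.fderiv_eq_zero hN _ _
  have hH : ContDiffAt ℝ ∞ (η ∘ e.symm) (e p) := by
    refine hN.contDiffAt_of_tangent ((hf.contMDiff _).contDiffAt_comp_atlas_symm hat hx)
      (hη.continuous.continuousAt.comp (contMDiffAt_atlas_symm hat hx).continuousAt)
      (Filter.Eventually.of_forall fun y ↦ hη.unit _) ?_ ?_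
    · filter_upwards [e.open_target.mem_nhds hx] with y hy using (hL y hy).1
    · filter_upwards [e.open_target.mem_nhds hx] with y hy using (hL y hy).2
  refine ((contMDiffAt_iff_contDiffAt.2 hH).comp p (contMDiffAt_atlas hat hp)).congr_of_eventuallyEq
    ?_
  filter_upwards [e.open_source.mem_nhds hp] with q hq
  simp [e.left_inv hq]

/-- The differential of the Birkhoff-Gauss map takes values in the tangent plane. -/
theorem IsBirkhoffGaussMap.exists_mvfderiv_eq (hN : IsMinkowskiNorm N)
    (hf : Manifold.IsImmersion (𝓡 2) 𝓘(ℝ, E3) ∞ f) (hη : IsBirkhoffGaussMap N f η)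
    (v : TangentSpace (𝓡 2) p) : ∃ w, mvfderiv (𝓡 2) f p w = mvfderiv (𝓡 2) η p v := by
  have hx0 := ne_zero_of_seminorm_eq_one (hη.unit p)
  have hinj := (hf.isImmersionAt p).mvfderiv_injective
  set A : EuclideanSpace ℝ (Fin 2) →ₗ[ℝ] E3 :=
    ContinuousLinearMap.toLinearMap (mvfderiv (𝓡 2) f p) with hA
  set l : E3 →ₗ[ℝ] ℝ := ContinuousLinearMap.toLinearMap (fderiv ℝ N (η p)) with hl
  have hle : LinearMap.range A ≤ LinearMap.ker l := by
    rintro _ ⟨w, rfl⟩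
    exact hη.fderiv_eq_zero hN p w
  have hl1 : LinearMap.range l = ⊤ := LinearMap.range_eq_top.2 <| l.surjective (fun h ↦ by
    have h1 := hN.fderiv_self hx0
    rw [hη.unit] at h1
    exact one_ne_zero (h1.symm.trans (congrArg (fun m ↦ m (η p)) h)))
  have heq : LinearMap.range A = LinearMap.ker l := by
    apply Submodule.eq_of_le_of_finrank_eq hle
    have h1 := l.finrank_range_add_finrank_ker
    rw [hl1, finrank_top, Module.finrank_self, finrank_euclideanSpace_fin] at h1
    have h2 := LinearMap.finrank_range_of_inj (f := A) hinj
    rw [finrank_euclideanSpace_fin] at h2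
    omega
  -- Differentiate `N ∘ η = 1`.
  have hker : mvfderiv (𝓡 2) η p v ∈ LinearMap.ker l := by
    have hηd : MDifferentiableAt (𝓡 2) 𝓘(ℝ, E3) η p :=
      (hη.contMDiff hN hf p).mdifferentiableAt (by simp)
    have hc : HasMFDerivAt (𝓡 2) 𝓘(ℝ, ℝ) (N ∘ η) p
        ((fderiv ℝ N (η p)) ∘L (mfderiv (𝓡 2) 𝓘(ℝ, E3) η p)) :=
      (hN.differentiableAt hx0).hasFDerivAt.hasMFDerivAt.comp p hηd.hasMFDerivAt
    have hconst : N ∘ η = fun _ ↦ (1 : ℝ) := funext hη.unit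
    rw [hconst] at hc
    have h0 := hasMFDerivAt_unique hc (hasMFDerivAt_const (1 : ℝ) p)
    exact congrArg (fun m ↦ m v) h0
  rw [← heq] at hker
  exact hker

/-- In the chart, `dη` is `df` preceded by an endomorphism conjugate to the one defining `K`, so
`det3_linear_comp` produces the factor `K`. The coefficient is nonzero because `dN` kills the
tangent plane while Euler's identity gives `dN (η p) = 1` at `η p`. -/
theorem areaCoefficient_eq_minkowskiGaussCurvature_mul (hN : IsMinkowskiNorm N)
    (hf : Manifold.IsImmersion (𝓡 2) 𝓘(ℝ, E3) ∞ f) (hη : IsBirkhoffGaussMap N f η)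
    (he : e ∈ atlas (EuclideanSpace ℝ (Fin 2)) M) (hp : p ∈ e.source) :
    areaCoefficient f η e (e p) ≠ 0 ∧ areaCoefficient η η e (e p) =
      minkowskiGaussCurvature f η p * areaCoefficient f η e (e p) := by
  obtain ⟨L, hL⟩ := exists_fderiv_comp_symm_eq
    (IsManifold.subset_maximalAtlas (I := 𝓡 2) (n := ∞) he) hp
  have hLf := hL f ((hf.contMDiff _).mdifferentiableAt (by simp))
  have hLη := hL η ((hη.contMDiff hN hf _).mdifferentiableAt (by simp))
  have hinj := (hf.isImmersionAt p).mvfderiv_injective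
  set A : TangentSpace (𝓡 2) p →ₗ[ℝ] E3 :=
    ContinuousLinearMap.toLinearMap (mvfderiv (𝓡 2) f p) with hA
  set C : TangentSpace (𝓡 2) p →ₗ[ℝ] E3 :=
    ContinuousLinearMap.toLinearMap (mvfderiv (𝓡 2) η p) with hC
  have hLf : ∀ v, fderiv ℝ (f ∘ e.symm) (e p) v = A (L v) := hLf
  have hLη : ∀ v, fderiv ℝ (η ∘ e.symm) (e p) v = C (L v) := hLη
  set T := A.leftInverse ∘ₗ C with hT
  have hAT (v) : A (T v) = C v := by
    obtain ⟨w, hw⟩ := hη.exists_mvfderiv_eq hN hf v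
    have hw : A w = C v := hw
    rw [hT, LinearMap.comp_apply, ← hw,
      LinearMap.leftInverse_apply_of_inj (LinearMap.ker_eq_bot.2 hinj)]
  have hK : minkowskiGaussCurvature f η p =
      LinearMap.det (L.symm.toLinearMap ∘ₗ T ∘ₗ L.toLinearMap) :=
    (LinearMap.det_conj T L.symm).symm
  constructor
  · rw [areaCoefficient, hLf, hLf, e.left_inv hp]
    refine det3_ne_zero (B := A ∘ₗ L.toLinearMap) (hinj.comp L.injective)
      (l := ContinuousLinearMap.toLinearMap (fderiv ℝ N (η p)))
      (fun v ↦ hη.fderiv_eq_zero hN p (L v)) ?_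
    have h1 := hN.fderiv_self (ne_zero_of_seminorm_eq_one (hη.unit p))
    rw [hη.unit] at h1
    exact h1.trans_ne one_ne_zero
  · rw [hK, areaCoefficient, areaCoefficient, hLf, hLf, hLη, hLη]
    have := det3_linear_comp (L.symm.toLinearMap ∘ₗ T ∘ₗ L.toLinearMap)
      (A ∘ₗ L.toLinearMap) (η (e.symm (e p)))
    simpa [hAT] using this

/-- The chosen left inverse in the definition of `K` hides its dependence on the point; locally `K`
is a quotient of two continuous area coefficients. -/
theorem continuous_minkowskiGaussCurvature (hN : IsMinkowskiNorm N)
    (hf : Manifold.IsImmersion (𝓡 2) 𝓘(ℝ, E3) ∞ f) (hη : IsBirkhoffGaussMap N f η) :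
    Continuous (minkowskiGaussCurvature f η) := by
  rw [continuous_iff_continuousAt]
  intro p
  set e := chartAt (EuclideanSpace ℝ (Fin 2)) p
  have hat : e ∈ atlas (EuclideanSpace ℝ (Fin 2)) M := chart_mem_atlas _ p
  have hp : p ∈ e.source := mem_chart_source _ p
  have hx : e p ∈ e.target := e.map_source hp
  have hc (g : M → E3) (hg : ContMDiff (𝓡 2) 𝓘(ℝ, E3) ∞ g) :
      ContinuousAt (fun q ↦ areaCoefficient g η e (e q)) p :=
    ContinuousAt.comp (g := areaCoefficient g η e) (f := e)
      ((continuousOn_areaCoefficient hg hη.continuous hat).continuousAt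
        (e.open_target.mem_nhds hx)) (e.continuousAt hp)
  refine ((hc η (hη.contMDiff hN hf)).div (hc f hf.contMDiff)
    (areaCoefficient_eq_minkowskiGaussCurvature_mul hN hf hη hat hp).1).congr ?_
  filter_upwards [e.open_source.mem_nhds hp] with q hq
  obtain ⟨h0, h1⟩ := areaCoefficient_eq_minkowskiGaussCurvature_mul hN hf hη hat hq
  rw [Pi.div_apply, h1, mul_div_cancel_right₀ _ h0]

end Geometry

theorem IsMinkowskiNorm.contMDiff_unitSphereEmbedding {N : Seminorm ℝ E3}
    (hN : IsMinkowskiNorm N) : ContMDiff (𝓡 2) 𝓘(ℝ, E3) ∞ (unitSphereEmbedding N) := by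
  have : Fact (Module.finrank ℝ E3 = 2 + 1) := ⟨by simp⟩
  intro q
  have hq : (q : E3) ≠ 0 := ne_zero_of_mem_unit_sphere q
  have hNq : N (q : E3) ≠ 0 := fun h ↦ hq (hN.eq_zero_of_apply_eq_zero _ h)
  have h1 : ContDiffAt ℝ ∞ (fun x : E3 ↦ (N x)⁻¹ • x) q :=
    ((hN.contDiffAt hq).inv hNq).smul contDiffAt_id
  exact ContMDiffAt.comp (g := fun x : E3 ↦ (N x)⁻¹ • x) (f := Subtype.val) q
    (contMDiffAt_iff_contDiffAt.2 h1) (contMDiff_coe_sphere q)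

/-! ### Area of the Gauss image, and the Gauss map as a local homeomorphism. -/

section Geometry

variable {M : Type*} [TopologicalSpace M] [ChartedSpace (EuclideanSpace ℝ (Fin 2)) M]
  [IsManifold (𝓡 2) ∞ M] {M' : Type*} [TopologicalSpace M']
  [ChartedSpace (EuclideanSpace ℝ (Fin 2)) M'] [IsManifold (𝓡 2) ∞ M']
  {N : Seminorm ℝ E3} {f η : M → E3}

/-- The area element with respect to `η` of the Birkhoff-Gauss map `η`, as a parametrized surface,
is the area element of the surface times the Minkowski Gaussian curvature. -/
theorem areaMeasure_birkhoffGaussMap [CompactSpace M] [MeasurableSpace M] [BorelSpace M]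
    (hN : IsMinkowskiNorm N) (hf : Manifold.IsImmersion (𝓡 2) 𝓘(ℝ, E3) ∞ f)
    (hη : IsBirkhoffGaussMap N f η) :
    areaMeasure η η = (areaMeasure f η).withDensity
      fun p ↦ ENNReal.ofReal |minkowskiGaussCurvature f η p| := by
  have hK : Measurable fun p ↦ ENNReal.ofReal |minkowskiGaussCurvature f η p| :=
    ((continuous_minkowskiGaussCurvature hN hf hη).abs.measurable).ennreal_ofReal
  refine Measure.ext_of_locally_eq fun p ↦ ?_
  set e := chartAt (EuclideanSpace ℝ (Fin 2)) p
  have hat : e ∈ atlas (EuclideanSpace ℝ (Fin 2)) M := chart_mem_atlas _ p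
  refine ⟨e.source, e.open_source, mem_chart_source _ _, ?_⟩
  rw [restrict_withDensity e.open_source.measurableSet,
    areaMeasure_restrict_source (hη.contMDiff hN hf) hat,
    areaMeasure_restrict_source hf.contMDiff hat]
  have hηs := hη.contMDiff hN hf
  have hJ {F : M → E3} (hF : ContMDiff (𝓡 2) 𝓘(ℝ, E3) ∞ F) :
      AEMeasurable (fun x ↦ ENNReal.ofReal |areaCoefficient F η e x|)
        (volume.restrict e.target) :=
    (((continuousOn_areaCoefficient hF hη.continuous hat).abs).aemeasurable
      e.open_target.measurableSet).ennreal_ofReal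
  have hsymm {J : EuclideanSpace ℝ (Fin 2) → ENNReal} :
      AEMeasurable e.symm ((volume.restrict e.target).withDensity J) :=
    (aemeasurable_symm_chart e).mono_ac (withDensity_absolutelyContinuous _ _)
  -- Tested against `g`, both sides become integrals over the chart domain, whose integrands agree
  -- by the pointwise identity between area coefficients.
  refine Measure.ext_of_lintegral _ fun g hg ↦ ?_
  rw [lintegral_withDensity_eq_lintegral_mul _ hK hg, chartAreaMeasure, chartAreaMeasure,
    lintegral_map' (hK.mul hg).aemeasurable hsymm, lintegral_map' hg.aemeasurable hsymm]
  have hpull (J : EuclideanSpace ℝ (Fin 2) → ENNReal) (hJ : AEMeasurable J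
      (volume.restrict e.target)) (k : M → ENNReal) (hk : Measurable k) :
      ∫⁻ x, k (e.symm x) ∂(volume.restrict e.target).withDensity J =
        ∫⁻ x in e.target, J x * k (e.symm x) :=
    lintegral_withDensity_eq_lintegral_mul₀ hJ
      (hk.comp_aemeasurable (aemeasurable_symm_chart e))
  rw [hpull _ (hJ hηs) g hg, hpull _ (hJ hf.contMDiff) _ (hK.mul hg)]
  refine setLIntegral_congr_fun e.open_target.measurableSet fun x hx ↦ ?_
  have h := (areaCoefficient_eq_minkowskiGaussCurvature_mul hN hf hη hat (e.map_target hx)).2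
  rw [e.right_inv hx] at h
  simp only [Pi.mul_apply, h, abs_mul, ENNReal.ofReal_mul (abs_nonneg _)]
  ring

/-- A smooth map between surfaces that pulls back some area element to a nowhere vanishing one
is a local homeomorphism. -/
theorem isLocalHomeomorph_of_areaCoefficient_ne_zero {ψ : M → M'}
    (hψ : ContMDiff (𝓡 2) (𝓡 2) ∞ ψ) {F G : M' → E3} (hF : ContMDiff (𝓡 2) 𝓘(ℝ, E3) ∞ F)
    (h : ∀ p, areaCoefficient (F ∘ ψ) (G ∘ ψ) (chartAt (EuclideanSpace ℝ (Fin 2)) p)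
      (chartAt (EuclideanSpace ℝ (Fin 2)) p p) ≠ 0) : IsLocalHomeomorph ψ := by
  refine IsLocalHomeomorph.mk ψ fun p ↦ ?_
  have hp0 := h p
  set e := chartAt (EuclideanSpace ℝ (Fin 2)) p
  set e' := chartAt (EuclideanSpace ℝ (Fin 2)) (ψ p)
  have hat : e ∈ atlas (EuclideanSpace ℝ (Fin 2)) M := chart_mem_atlas _ p
  have hat' : e' ∈ atlas (EuclideanSpace ℝ (Fin 2)) M' := chart_mem_atlas _ (ψ p)
  have hp : p ∈ e.source := mem_chart_source _ p
  have hp' : ψ (e.symm (e p)) ∈ e'.source := by rw [e.left_inv hp]; exact mem_chart_source _ _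
  have hx : e p ∈ e.target := e.map_source hp
  have hg := hψ.contDiffAt_transition hat hat' hx hp'
  rw [areaCoefficient_comp hψ hF hat hat' hx hp'] at hp0
  -- The pulled-back coefficient contains the Jacobian of `ψ` in charts as a factor, so the inverse
  -- function theorem applies.
  have hdet := left_ne_zero_of_mul hp0
  let L := (fderiv ℝ (e' ∘ ψ ∘ e.symm) (e p)).toContinuousLinearEquivOfDetNeZero hdet
  have hL : HasFDerivAt (e' ∘ ψ ∘ e.symm)
      (L : EuclideanSpace ℝ (Fin 2) →L[ℝ] EuclideanSpace ℝ (Fin 2)) (e p) := by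
    rw [ContinuousLinearMap.coe_toContinuousLinearEquivOfDetNeZero]
    exact (hg.differentiableAt (by simp)).hasFDerivAt
  set T := hg.toOpenPartialHomeomorph (e' ∘ ψ ∘ e.symm) hL (by simp) with hT
  have hTc : (T : EuclideanSpace ℝ (Fin 2) → EuclideanSpace ℝ (Fin 2)) = e' ∘ ψ ∘ e.symm :=
    hg.toOpenPartialHomeomorph_coe hL (by simp)
  have hTm : e p ∈ T.source := hg.mem_toOpenPartialHomeomorph_source hL (by simp)
  have hU : IsOpen (ψ ⁻¹' e'.source) := e'.open_source.preimage hψ.continuous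
  refine ⟨(e.restr (ψ ⁻¹' e'.source) ≫ₕ T) ≫ₕ e'.symm, ?_, ?_⟩
  · simp only [OpenPartialHomeomorph.trans_source, OpenPartialHomeomorph.restr_source,
      hU.interior_eq, mem_inter_iff, mem_preimage, OpenPartialHomeomorph.symm_source,
      OpenPartialHomeomorph.coe_trans, Function.comp_apply, OpenPartialHomeomorph.restr_apply, hTc]
    exact ⟨⟨⟨hp, mem_chart_source _ _⟩, hTm⟩, e'.map_source hp'⟩
  · intro q hq
    simp only [OpenPartialHomeomorph.trans_source, OpenPartialHomeomorph.restr_source,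
      hU.interior_eq, mem_inter_iff, mem_preimage] at hq
    simp only [OpenPartialHomeomorph.coe_trans, Function.comp_apply,
      OpenPartialHomeomorph.restr_apply, hTc]
    rw [e.left_inv hq.1.1.1, e'.left_inv hq.1.1.2]

end Geometry

/-! ### Global bijectivity and the total curvature. -/

theorem isConnected_sphere_E3 : IsConnected (Metric.sphere (0 : E3) 1) :=
  isConnected_sphere (by rw [← Module.finrank_eq_rank]; simp) 0 zero_le_one

/-- A local homeomorphism from a compact connected space to the two-sphere is a homeomorphism. -/
theorem IsLocalHomeomorph.bijective_of_sphere {M : Type*} [TopologicalSpace M] [CompactSpace M]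
    [ConnectedSpace M] [T2Space M] {ψ : M → Metric.sphere (0 : E3) 1} (hψ : IsLocalHomeomorph ψ) :
    Function.Bijective ψ := by
  refine ⟨(isLocalHomeomorph_iff_isCoveringMap.1 hψ).injective_of_sphere, ?_⟩
  have : ConnectedSpace (Metric.sphere (0 : E3) 1) :=
    isConnected_iff_connectedSpace.1 isConnected_sphere_E3
  rw [← range_eq_univ]
  -- The image is compact, hence closed, and open because a local homeomorphism is an open map.
  exact IsClopen.eq_univ ⟨(isCompact_range hψ.continuous).isClosed, hψ.isOpenMap.isOpen_range⟩
    (range_nonempty ψ)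

end

theorem theorem4p1 (N : Seminorm ℝ E3) (hN : IsMinkowskiNorm N)
    {M : Type*} [TopologicalSpace M] [ChartedSpace (EuclideanSpace ℝ (Fin 2)) M]
    [IsManifold (𝓡 2) ∞ M] [CompactSpace M] [ConnectedSpace M]
    [MeasurableSpace M] [BorelSpace M]
    (f η : M → E3) (hf : Manifold.IsSmoothEmbedding (𝓡 2) 𝓘(ℝ, E3) ∞ f)
    (hη : IsBirkhoffGaussMap N f η)
    (hK : ∀ p, 0 < minkowskiGaussCurvature f η p) :
    Integrable (minkowskiGaussCurvature f η) (areaMeasure f η) ∧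
      ∫ p, minkowskiGaussCurvature f η p ∂(areaMeasure f η) = unitSphereArea N := by
  have : Fact (Module.finrank ℝ E3 = 2 + 1) := ⟨by simp⟩
  have : T2Space M := hf.isEmbedding.t2Space
  have hfi := hf.isImmersion
  have hηs := hη.contMDiff hN hfi
  have hη0 (p) : η p ≠ 0 := ne_zero_of_seminorm_eq_one (hη.unit p)
  have hmem (p) : ‖η p‖⁻¹ • η p ∈ Metric.sphere (0 : E3) 1 := by
    rw [mem_sphere_zero_iff_norm, norm_smul, norm_inv, norm_norm,
      inv_mul_cancel₀ (norm_ne_zero_iff.2 (hη0 p))]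
  have hνs : ContMDiff (𝓡 2) 𝓘(ℝ, E3) ∞ fun p ↦ ‖η p‖⁻¹ • η p := fun p ↦
    ContMDiffAt.comp (g := fun x : E3 ↦ ‖x‖⁻¹ • x) (f := η) p
      (contMDiffAt_iff_contDiffAt.2 (((contDiffAt_id.norm ℝ (hη0 p)).inv
        (norm_ne_zero_iff.2 (hη0 p))).smul contDiffAt_id)) (hηs p)
  -- The Euclidean unit sphere serves as the manifold parametrizing `∂B`, so `η` is rescaled to
  -- Euclidean length one; `unitSphereEmbedding N` undoes the rescaling since `N (η p) = 1`.
  set ψ : M → Metric.sphere (0 : E3) 1 := codRestrict _ _ hmem with hψ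
  have hψs : ContMDiff (𝓡 2) (𝓡 2) ∞ ψ := hνs.codRestrict_sphere hmem
  have hcomp : unitSphereEmbedding N ∘ ψ = η := by
    ext1 p
    have hn := norm_ne_zero_iff.2 (hη0 p)
    simp only [Function.comp_apply, unitSphereEmbedding, hψ, val_codRestrict_apply,
      map_smul_eq_mul, hη.unit, norm_inv, norm_norm, mul_one, inv_inv]
    rw [smul_smul, mul_inv_cancel₀ hn, one_smul]
  have hιs := hN.contMDiff_unitSphereEmbedding
  have hloc : IsLocalHomeomorph ψ := by
    refine isLocalHomeomorph_of_areaCoefficient_ne_zero (G := unitSphereEmbedding N) hψs hιs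
      fun p ↦ ?_
    obtain ⟨h0, h1⟩ := areaCoefficient_eq_minkowskiGaussCurvature_mul hN hfi hη
      (chart_mem_atlas (EuclideanSpace ℝ (Fin 2)) p) (mem_chart_source _ p)
    rw [hcomp, h1]
    exact mul_ne_zero (hK p).ne' h0
  let Ψ : M ≃ₜ Metric.sphere (0 : E3) 1 := Continuous.homeoOfEquivCompactToT2
    (f := Equiv.ofBijective ψ hloc.bijective_of_sphere) hloc.continuous
  have harea : areaMeasure η η univ =
      areaMeasure (unitSphereEmbedding N) (unitSphereEmbedding N) univ := by
    have := areaMeasure_univ_comp Ψ hψs (η := unitSphereEmbedding N) hιs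
    have hΨ : unitSphereEmbedding N ∘ Ψ = η := hcomp
    rwa [hΨ] at this
  have hlint : ∫⁻ p, ENNReal.ofReal (minkowskiGaussCurvature f η p) ∂(areaMeasure f η) =
      areaMeasure (unitSphereEmbedding N) (unitSphereEmbedding N) univ := by
    rw [← harea, areaMeasure_birkhoffGaussMap hN hfi hη, withDensity_apply _ MeasurableSet.univ,
      Measure.restrict_univ]
    simp only [abs_of_pos (hK _)]
  have hfin : IsFiniteMeasure (areaMeasure (unitSphereEmbedding N) (unitSphereEmbedding N)) :=
    isFiniteMeasure_areaMeasure hιs hιs.continuous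
  have hmeas : AEStronglyMeasurable (minkowskiGaussCurvature f η) (areaMeasure f η) :=
    (continuous_minkowskiGaussCurvature hN hfi hη).measurable.aestronglyMeasurable
  have hnn : 0 ≤ᵐ[areaMeasure f η] minkowskiGaussCurvature f η :=
    Filter.Eventually.of_forall fun p ↦ (hK p).le
  refine ⟨⟨hmeas, ?_⟩, ?_⟩
  · rw [hasFiniteIntegral_iff_ofReal hnn, hlint]
    exact measure_lt_top _ _
  · rw [integral_eq_lintegral_of_nonneg_ae hnn hmeas, hlint]
    rfl
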